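/- **Setting.** A PESP instance $I=(G,T,\ell,u,w)$ consists of a finite digraph $G=(V,A)$ (parallel arcs and loops allowed), an integer $T\ge 2$, bounds $\ell,u\in\mathbb Z^A$ and weights $w\in\mathbb R^A$. The cycle space $\mathcal C$ is the group of all $\gamma\in\mathbb Z^A$ with $\sum_{a\in\delta^+(i)}\gamma_a=\sum_{a\in\delta^-(i)}\gamma_a$ for all $i\in V$. An integral cycle basis is a $\mathbb Z$-basis $B$ of $\mathcal C$ whose elements lie in $\{-1,0,1\}^A$; its cycle matrix $\Gamma\in\{-1,0,1\}^{B\times A}$ has the elements of $B$ as rows. The fractional periodic timetabling polytope (the LP relaxation of the cycle-based formulation) is $$\mathcal P=\{(x,z)\in\mathbb R^A\times\mathbb R^B \mid \Gamma x=Tz,\ \ell\le x\le u\},$$ where $x$ is continuous and $z$ is the vector of integer variables. For a polyhedron $P\subseteq\mathbb R^n\times\mathbb R^p$ with $n$ continuous and $p$ integer variables, its split closure is $$P_{\mathrm{split}}=\bigcap_{(\beta,\beta_0)\in\mathbb Z^p\times\mathbb Z}\operatorname{conv}\big(\{(x,z)\in P\mid\beta^\top z\le\beta_0\}\cup\{(x,z)\in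 P\mid\beta^\top z\ge\beta_0+1\}\big).$$ An instance $I'$ with the same $T$ is a simple free augmentation of $I$ if $I$ arises from $I'$ by deleting one arc $\overline a$ with $u'_{\overline a}-\ell'_{\overline a}=T-1$, possibly together with end vertices of $\overline a$ that this deletion leaves isolated. **Theorem.** (1) Suppose that $I'$ arises from $I$ by a finite sequence of simple free augmentations, and let $\mathcal P$, $\mathcal P'$ be the fractional periodic timetabling polytopes of $I$, $I'$ with respect to integral cycle bases $B$, $B'$ with cycle matrices $\Gamma,\Gamma'$. (a) If $B'$ contains $B$ (its elements being extended by zero to the arcs of $I'$), then the natural coordinate projection $\varphi$, $(x',z')\mapsto(x'|_A,z'|_B)$, maps $\mathcal P'$ into $\mathcal P$ and satisfies $\varphi(\mathcal P'_{\mathrm{split}})=\mathcal P_{\mathrm{split}}$. (b) For arbitrary integral cycle bases $B,B'$ there is a unique integral matrix $U\in\mathbb Z^{B\times B'}$ such that the rows of $U\Gamma'$ are the rows of $\Gamma$ extended by zero, and the natural projection $\varphi:(x',z')\mapsto(x'|_A,Uz')$ maps $\mathcal P'$ into $\mathcal P$ and satisfies $\varphi(\mathcal P'_{\mathrm{split}})=\mathcal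 P_{\mathrm{split}}$. (2) In particular, the incidence-based formulation has no stronger split closure than the cycle-based one: let $\mathcal Q$ be the set of all $(x,\pi,p)\in\mathbb R^A\times\mathbb R^V\times\mathbb R^A$ with $x_a=\pi_j-\pi_i+Tp_a$ for all $a=(i,j)\in A$, $\ell\le x\le u$ and $0\le\pi_i\le T-1$ for all $i\in V$, where $x,\pi$ are continuous and $p$ is the vector of integer variables. Then for every integral cycle basis with cycle matrix $\Gamma$ the map $(x,\pi,p)\mapsto(x,\Gamma p)$ maps $\mathcal Q$ into $\mathcal P$ and maps $\mathcal Q_{\mathrm{split}}$ onto $\mathcal P_{\mathrm{split}}$. -/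

import Mathlib

universe u v w

/-- The polyhedron `P^(β, β₀)` of a split `(β, β₀)`: the convex hull of the two sides of the split
disjunction. The first component of a point is its continuous part, the second its integer part. -/
def splitHull {n p : Type*} [Fintype p] (P : Set ((n → ℝ) × (p → ℝ))) (β : p → ℤ) (β₀ : ℤ) :
    Set ((n → ℝ) × (p → ℝ)) :=
  convexHull ℝ ({q ∈ P | ∑ k, (β k : ℝ) * q.2 k ≤ (β₀ : ℝ)} ∪
    {q ∈ P | (β₀ : ℝ) + 1 ≤ ∑ k, (β k : ℝ) * q.2 k})

/-- The split closure of the polyhedron `P`, with continuous variables indexed by `n` and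
integer variables indexed by `p`. -/
def splitClosure {n p : Type*} [Fintype p] (P : Set ((n → ℝ) × (p → ℝ))) :
    Set ((n → ℝ) × (p → ℝ)) :=
  ⋂ (β : p → ℤ) (β₀ : ℤ), splitHull P β β₀

/-- An instance `(G, T, ℓ, u, w)` of the Periodic Event Scheduling Problem. The digraph `G` is
finite, and parallel arcs and loops are permitted. -/
structure PESPInstance where
  /-- vertices (events) -/
  V : Type u
  /-- arcs (activities) -/
  A : Type v
  [fintypeV : Fintype V]
  [fintypeA : Fintype A]
  /-- tail of an arc -/
  src : A → V
  /-- head of an arc -/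
  tgt : A → V
  /-- period time -/
  T : ℕ
  two_le_T : 2 ≤ T
  /-- lower bounds -/
  lower : A → ℤ
  /-- upper bounds -/
  upper : A → ℤ
  /-- weights -/
  weight : A → ℝ

attribute [instance] PESPInstance.fintypeV PESPInstance.fintypeA

namespace PESPInstance

open scoped Classical in
/-- The cycle space: integer vectors on the arcs with, at every vertex, equal total over the
outgoing arcs and over the incoming arcs. -/
def cycleSpace (I : PESPInstance.{u, v}) : Submodule ℤ (I.A → ℤ) where
  carrier := {γ | ∀ i : I.V,
    (∑ a ∈ Finset.univ.filter (fun a => I.src a = i), γ a) =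
      ∑ a ∈ Finset.univ.filter (fun a => I.tgt a = i), γ a}
  add_mem' := by
    intro γ δ hγ hδ i
    simp only [Pi.add_apply, Finset.sum_add_distrib]
    rw [hγ i, hδ i]
  zero_mem' := by
    intro i
    simp
  smul_mem' := by
    intro c γ hγ i
    simp only [Pi.smul_apply, ← Finset.smul_sum]
    rw [hγ i]

/-- An oriented cycle: an element of the cycle space with entries in `{-1, 0, 1}`. -/
def IsOrientedCycle (I : PESPInstance.{u, v}) (γ : I.A → ℤ) : Prop :=
  γ ∈ I.cycleSpace ∧ ∀ a, γ a = -1 ∨ γ a = 0 ∨ γ a = 1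

/-- `Γ` is the cycle matrix of an integral cycle basis: its rows (indexed by `B`) are oriented
cycles and form a `ℤ`-basis of the cycle space. -/
def IsCycleMatrix (I : PESPInstance.{u, v}) {B : Type w} (Γ : Matrix B I.A ℤ) : Prop :=
  (∀ b, I.IsOrientedCycle (Γ b)) ∧
    LinearIndependent ℤ (fun b => Γ b) ∧
    Submodule.span ℤ (Set.range fun b => Γ b) = I.cycleSpace

/-- The fractional periodic timetabling polytope, i.e. the linear relaxation of the cycle-based
formulation: `Γ x = T z`, `ℓ ≤ x ≤ u`. -/
def fracPolytope (I : PESPInstance.{u, v}) {B : Type w} (Γ : Matrix B I.A ℤ) :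
    Set ((I.A → ℝ) × (B → ℝ)) :=
  {q | (∀ b, ∑ a, (Γ b a : ℝ) * q.1 a = (I.T : ℝ) * q.2 b) ∧
    ∀ a, (I.lower a : ℝ) ≤ q.1 a ∧ q.1 a ≤ (I.upper a : ℝ)}

/-- The linear relaxation of the incidence-based formulation: `x_a = π_j - π_i + T p_a` for
`a = (i, j)`, `ℓ ≤ x ≤ u`, `0 ≤ π ≤ T - 1`. The continuous variables are the tensions `x_a`
(coordinates `Sum.inl a`) and the potentials `π_i` (coordinates `Sum.inr i`); the integer
variables are the offsets `p_a`. -/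
def incidencePolytope (I : PESPInstance.{u, v}) :
    Set ((I.A ⊕ I.V → ℝ) × (I.A → ℝ)) :=
  {q | (∀ a, q.1 (Sum.inl a) =
      q.1 (Sum.inr (I.tgt a)) - q.1 (Sum.inr (I.src a)) + (I.T : ℝ) * q.2 a) ∧
    (∀ a, (I.lower a : ℝ) ≤ q.1 (Sum.inl a) ∧ q.1 (Sum.inl a) ≤ (I.upper a : ℝ)) ∧
    ∀ i, 0 ≤ q.1 (Sum.inr i) ∧ q.1 (Sum.inr i) ≤ (I.T : ℝ) - 1}

/-- `I'` is a simple free augmentation of `I`: `I` arises from `I'` by deleting one arc `abar`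
with `u' - ℓ' = T - 1`. The arcs of `I` are identified through `e` with the arcs of `I'` other
than `abar`. The vertices of `I` are identified through `f` with vertices of `I'`; the only
vertices of `I'` that may be new are end vertices of `abar` (so adding an arc towards a new vertex
is permitted). -/
def IsSimpleFreeAugmentation (I I' : PESPInstance.{u, v}) (e : I.A → I'.A) : Prop :=
  ∃ (f : I.V → I'.V) (abar : I'.A),
    Function.Injective f ∧ Function.Injective e ∧
    (∀ a', a' ∈ Set.range e ↔ a' ≠ abar) ∧
    (∀ i', i' ∈ Set.range f ∨ i' = I'.src abar ∨ i' = I'.tgt abar) ∧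
    (∀ a, I'.src (e a) = f (I.src a) ∧ I'.tgt (e a) = f (I.tgt a)) ∧
    I'.T = I.T ∧
    (∀ a, I'.lower (e a) = I.lower a ∧ I'.upper (e a) = I.upper a ∧
      I'.weight (e a) = I.weight a) ∧
    I'.upper abar - I'.lower abar = (I'.T : ℤ) - 1

/-- `I'` arises from `I` by a finite (possibly empty) sequence of simple free augmentations; the
last argument is the resulting inclusion of the arcs of `I` into those of `I'`. -/
inductive IsFreeAugmentation (I : PESPInstance.{u, v}) :
    (I' : PESPInstance.{u, v}) → (I.A → I'.A) → Prop
  | refl : IsFreeAugmentation I I id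
  | step {I' I'' : PESPInstance.{u, v}} {e : I.A → I'.A} {e' : I'.A → I''.A} :
      IsFreeAugmentation I I' e → IsSimpleFreeAugmentation I' I'' e' →
        IsFreeAugmentation I I'' (e' ∘ e)

end PESPInstance

/-- The coordinate projection forgetting all coordinates of arcs outside the image of `e` and of
basis cycles outside the image of `j`. -/
def coordProj {A A' B B' : Type*} (e : A → A') (j : B → B') (q : (A' → ℝ) × (B' → ℝ)) :
    (A → ℝ) × (B → ℝ) :=
  (q.1 ∘ e, q.2 ∘ j)

/-- The rows of `Γ'` indexed by the image of `j` are the rows of `Γ`, extended by zero along the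
inclusion `e` of arcs: the cycle basis of `Γ'` contains that of `Γ`. -/
def ExtendsCycleMatrix {A A' B B' : Type*} (e : A → A') (j : B → B') (Γ : Matrix B A ℤ)
    (Γ' : Matrix B' A' ℤ) : Prop :=
  ∀ b, Γ' (j b) = Function.extend e (Γ b) 0

/-- `U` expresses the rows of `Γ`, extended by zero along `e`, as integral combinations of the
rows of `Γ'`. -/
def IsTransitionMatrix {A A' B B' : Type*} [Fintype B'] (e : A → A') (Γ : Matrix B A ℤ)
    (Γ' : Matrix B' A' ℤ) (U : Matrix B B' ℤ) : Prop :=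
  ∀ b, (U * Γ') b = Function.extend e (Γ b) 0

/-- The natural projection `(x', z') ↦ (x'|_A, U z')` when the two cycle bases are arbitrary. -/
def transitionProj {A A' B B' : Type*} [Fintype B'] (e : A → A') (U : Matrix B B' ℤ)
    (q : (A' → ℝ) × (B' → ℝ)) : (A → ℝ) × (B → ℝ) :=
  (q.1 ∘ e, fun b => ∑ b', (U b b' : ℝ) * q.2 b')

/-- The natural projection `(x, π, p) ↦ (x, Γ p)` from the incidence-based to the cycle-based
formulation. -/
def incidenceProj {A V B : Type*} [Fintype A] (Γ : Matrix B A ℤ)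
    (q : (A ⊕ V → ℝ) × (A → ℝ)) : (A → ℝ) × (B → ℝ) :=
  (q.1 ∘ Sum.inl, fun b => ∑ a, (Γ b a : ℝ) * q.2 a)

/-!
In each of the formulations the integer variables are determined by the continuous ones through
`M x = T z` with an integral matrix `M`, and `x` ranges over a box with integral bounds. Splitting
on `β z` therefore amounts to splitting the box on `γ x ≤ T β₀` or `γ x ≥ T (β₀ + 1)`, where `γ`
runs through the lattice spanned by the rows of `M` (`mem_splitClosure_relaxation`). For the
cycle-based formulation this lattice is the cycle space, whatever the basis. For the
incidence-based formulation it consists of the pairs of an integral vector on the arcs and its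
divergence on the vertices, so its elements supported on the arcs again form the cycle space. In
both parts of the theorem the additional coordinates (the new arcs, respectively the potentials)
have an interval of width `T - 1`. The statement thus reduces to one about an arbitrary lattice
`D` and a box: a point in the split region of the forms of `D` supported on a set of coordinates
extends, over one further coordinate `s` of width `T - 1`, to a point in the split region of the
forms of `D` supported on the larger set (`exists_update_mem_region`).

The hull of a single disjunction is described by flip inequalities (`Flip`, `exists_not_flip`),
one for each vertex `v` of the box. For the new coordinate these become lower and upper bounds, and
it suffices that each lower bound is at most each upper bound. If they come from forms `γ₁`, `γ₂`
with coefficients `k₁ > 0` and `-k₂ < 0` at `s` and residues `α₁`, `α₂`, compatibility is the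
inequality obtained by eliminating `s`, with right-hand side
`α = k₂ α₁ + k₁ α₂ - k₁ k₂ (T - 1)`. As residues are at most `T - 1`, this is nonpositive, and
nothing needs to be shown, unless one of `k₁`, `k₂` is `1`; and when it is positive it is at most
both `α₁` and `α₂` (`combined_residue`). Then the left-hand side dominates a function which is
affine on the box and at least `α` on both sides of a disjunction for `η = k₂ γ₁ + k₁ γ₂`, a form
that no longer involves `s` (`partialFlip_compatible`).
-/

namespace BoxSplit

variable {N : Type*}

/-! ### Split hulls of a box -/

/-- The box `ℓ ≤ x ≤ u` with integral bounds. -/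
def box (l u : N → ℤ) : Set (N → ℝ) :=
  {x | ∀ a, (l a : ℝ) ≤ x a ∧ x a ≤ (u a : ℝ)}

theorem convex_box (l u : N → ℤ) : Convex ℝ (box l u) := by
  intro x hx y hy a b ha hb hab i
  have h1 := hx i
  have h2 := hy i
  simp only [Pi.add_apply, Pi.smul_apply, smul_eq_mul]
  obtain rfl : b = 1 - a := by linarith
  constructor <;> nlinarith

/-- The function `w ↦ w⁺ + r w⁻`, for `0 ≤ r`. -/
def hinge (r w : ℝ) : ℝ := max w (-(r * w))

theorem hinge_of_nonneg {r w : ℝ} (hr : 0 ≤ r) (hw : 0 ≤ w) : hinge r w = w := by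
  have := mul_nonneg hr hw
  exact max_eq_left (by linarith)

theorem hinge_of_nonpos {r w : ℝ} (hr : 0 ≤ r) (hw : w ≤ 0) : hinge r w = -(r * w) := by
  have := mul_nonpos_of_nonneg_of_nonpos hr hw
  exact max_eq_right (by linarith)

theorem hinge_nonneg {r : ℝ} (hr : 0 ≤ r) (w : ℝ) : 0 ≤ hinge r w := by
  rcases le_total 0 w with hw | hw
  · rw [hinge_of_nonneg hr hw]; exact hw
  · rw [hinge_of_nonpos hr hw]; nlinarith

theorem hinge_mono {r r' : ℝ} (hr : 0 ≤ r) (h : r ≤ r') (w : ℝ) : hinge r w ≤ hinge r' w := by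
  rcases le_total 0 w with hw | hw
  · rw [hinge_of_nonneg hr hw, hinge_of_nonneg (hr.trans h) hw]
  · rw [hinge_of_nonpos hr hw, hinge_of_nonpos (hr.trans h) hw]; nlinarith

theorem hinge_eq {r : ℝ} (hr : 0 ≤ r) (w : ℝ) : hinge r w = max w 0 + r * max (-w) 0 := by
  rcases le_total 0 w with hw | hw
  · rw [hinge_of_nonneg hr hw, max_eq_left hw, max_eq_right (by linarith)]; ring
  · rw [hinge_of_nonpos hr hw, max_eq_right hw, max_eq_left (by linarith)]; ring

/-- The slope `α / (T - α)` for which `hinge` takes the value `α` at both `α` and `α - T`. -/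
noncomputable def slope (T : ℕ) (α : ℤ) : ℝ := (α : ℝ) / ((T : ℝ) - α)

theorem slope_nonneg {T : ℕ} {α : ℤ} (h0 : 0 ≤ α) (hT : α < T) : 0 ≤ slope T α := by
  have h1 : (0 : ℝ) ≤ α := by exact_mod_cast h0
  have h2 : (α : ℝ) < T := by exact_mod_cast hT
  exact div_nonneg h1 (by linarith)

theorem slope_mul {T : ℕ} {α : ℤ} (hT : α < T) : slope T α * ((T : ℝ) - α) = α := by
  have h2 : (α : ℝ) < T := by exact_mod_cast hT
  exact div_mul_cancel₀ _ (by linarith)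

theorem slope_mono {T : ℕ} {α α' : ℤ} (h0 : 0 ≤ α) (h : α ≤ α') (hT : α' < T) :
    slope T α ≤ slope T α' := by
  have h0' : (0 : ℝ) ≤ α := by exact_mod_cast h0
  have h1 : (α : ℝ) ≤ α' := by exact_mod_cast h
  have h2 : (α' : ℝ) < T := by exact_mod_cast hT
  exact div_le_div₀ (by linarith) h1 (by linarith) (by linarith)

/-- Anchoring at an end of the interval `[ℓ a, u a]` makes the sign of the argument constant on
the box, so that the convex function `hinge r` becomes affine there. -/
theorem concaveOn_hinge {l u v : N → ℤ} {a : N} (hv : v a = l a ∨ v a = u a) {r : ℝ}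
    (hr : 0 ≤ r) (c : ℤ) :
    ConcaveOn ℝ (box l u) fun x => hinge r ((c : ℝ) * (x a - v a)) := by
  have hsign : (∀ x ∈ box l u, 0 ≤ (c : ℝ) * (x a - v a)) ∨
      ∀ x ∈ box l u, (c : ℝ) * (x a - v a) ≤ 0 := by
    rcases le_total (0 : ℝ) (c : ℝ) with hc | hc <;> rcases hv with hv | hv <;> rw [hv]
    · exact Or.inl fun x hx => mul_nonneg hc (by linarith [(hx a).1])
    · exact Or.inr fun x hx => mul_nonpos_of_nonneg_of_nonpos hc (by linarith [(hx a).2])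
    · exact Or.inr fun x hx => mul_nonpos_of_nonpos_of_nonneg hc (by linarith [(hx a).1])
    · exact Or.inl fun x hx => mul_nonneg_of_nonpos_of_nonpos hc (by linarith [(hx a).2])
  refine ⟨convex_box l u, ?_⟩
  intro x hx y hy p q hp hq hpq
  have hz := convex_box l u hx hy hp hq hpq
  obtain rfl : q = 1 - p := by linarith
  rcases hsign with h | h
  · simp only [hinge_of_nonneg hr (h _ hx), hinge_of_nonneg hr (h _ hy),
      hinge_of_nonneg hr (h _ hz)]
    simp only [smul_eq_mul, Pi.add_apply, Pi.smul_apply]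
    apply le_of_eq; ring
  · simp only [hinge_of_nonpos hr (h _ hx), hinge_of_nonpos hr (h _ hy),
      hinge_of_nonpos hr (h _ hz)]
    simp only [smul_eq_mul, Pi.add_apply, Pi.smul_apply]
    apply le_of_eq; ring

theorem concaveOn_sum {ι : Type*} (t : Finset ι) {s : Set (N → ℝ)} (hs : Convex ℝ s)
    {f : ι → (N → ℝ) → ℝ} (hf : ∀ i ∈ t, ConcaveOn ℝ s (f i)) :
    ConcaveOn ℝ s fun x => ∑ i ∈ t, f i x := by
  refine ⟨hs, fun x hx y hy p q hp hq hpq => ?_⟩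
  simp only [smul_eq_mul, Finset.mul_sum, ← Finset.sum_add_distrib]
  exact Finset.sum_le_sum fun i hi => (hf i hi).2 hx hy hp hq hpq

variable [Fintype N]

/-- The value `∑ a, γ a * x a` of the integral linear form `γ`. -/
def pairing (γ : N → ℤ) (x : N → ℝ) : ℝ := ∑ a, (γ a : ℝ) * x a

/-- The convex hull of the two sides of the disjunction `γ x ≤ T β₀` or `γ x ≥ T (β₀ + 1)` on a
box. -/
def hull (T : ℕ) (l u : N → ℤ) (γ : N → ℤ) (β₀ : ℤ) : Set (N → ℝ) :=
  convexHull ℝ ({x ∈ box l u | pairing γ x ≤ (T : ℝ) * β₀} ∪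
    {x ∈ box l u | (T : ℝ) * β₀ + T ≤ pairing γ x})

/-- The points of the box that lie in the hulls of all disjunctions given by forms in `D`. -/
def region (T : ℕ) (l u : N → ℤ) (D : Set (N → ℤ)) : Set (N → ℝ) :=
  {x ∈ box l u | ∀ γ ∈ D, ∀ β₀, x ∈ hull T l u γ β₀}

/-- Any function that is concave on the box and dominates both `w` and `-r w`, for
`w = γ x - c` and `r = α / (T - α)`, is at least `α` on both sides of the disjunction for `γ` at
which `w` jumps from `α - T` to `α`, hence on its hull. -/
theorem le_of_forall_mem_hull {T : ℕ} {l u γ : N → ℤ} {Φ : (N → ℝ) → ℝ}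
    (hΦ : ConcaveOn ℝ (box l u) Φ) {α c : ℤ} (h0 : 0 ≤ α) (hT : α < T) (hc : (T : ℤ) ∣ α + c)
    (h1 : ∀ x ∈ box l u, pairing γ x - c ≤ Φ x)
    (h2 : ∀ x ∈ box l u, -(slope T α * (pairing γ x - c)) ≤ Φ x)
    {x : N → ℝ} (hx : ∀ β₀, x ∈ hull T l u γ β₀) : (α : ℝ) ≤ Φ x := by
  obtain ⟨m, hm⟩ := hc
  have hm' : (α : ℝ) + c = T * m := by exact_mod_cast hm
  have hsub : hull T l u γ (m - 1) ⊆ {x ∈ box l u | (α : ℝ) ≤ Φ x} := by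
    refine convexHull_min ?_ (hΦ.convex_ge _)
    rintro y (⟨hy, hle⟩ | ⟨hy, hle⟩)
    · refine ⟨hy, le_trans ?_ (h2 y hy)⟩
      push_cast at hle
      have := mul_le_mul_of_nonneg_left (show (T : ℝ) - α ≤ -(pairing γ y - c) by linarith)
        (slope_nonneg h0 hT)
      rw [slope_mul hT] at this
      linarith
    · refine ⟨hy, le_trans ?_ (h1 y hy)⟩
      push_cast at hle
      linarith
  exact (hsub (hx _)).2

/-! ### Flip inequalities -/

/-- The residue modulo `T` of `-γ v`. -/
def residue (T : ℕ) (γ v : N → ℤ) : ℤ := (-∑ a, γ a * v a) % T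

/-- The flip inequality of the integral form `γ` at the integral point `v`: the sum of
`w⁺ + α / (T - α) w⁻` over the coordinates, where `w a = γ a * (x a - v a)`, is at least the
residue `α` of `-γ v`. -/
def Flip (T : ℕ) (γ v : N → ℤ) (x : N → ℝ) : Prop :=
  (residue T γ v : ℝ) ≤ ∑ a, hinge (slope T (residue T γ v)) ((γ a : ℝ) * (x a - v a))

theorem residue_nonneg {T : ℕ} (hT : 0 < T) (γ v : N → ℤ) : 0 ≤ residue T γ v :=
  Int.emod_nonneg _ (by omega)

theorem residue_lt {T : ℕ} (hT : 0 < T) (γ v : N → ℤ) : residue T γ v < T :=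
  Int.emod_lt_of_pos _ (by omega)

theorem dvd_residue_add (T : ℕ) (γ v : N → ℤ) :
    (T : ℤ) ∣ residue T γ v + ∑ a, γ a * v a := by
  refine ⟨-((-∑ a, γ a * v a) / T), ?_⟩
  have := Int.emod_add_mul_ediv (-∑ a, γ a * v a) T
  unfold residue
  linarith

theorem residue_eq {T : ℕ} {γ v : N → ℤ} {α m : ℤ} (h0 : 0 ≤ α) (hT : α < T)
    (h : -∑ a, γ a * v a = α + T * m) : residue T γ v = α := by
  rw [residue, h, Int.add_mul_emod_self_left, Int.emod_eq_of_lt h0 hT]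

theorem flip_of_forall_mem_hull {T : ℕ} (hT : 0 < T) {l u γ v : N → ℤ}
    (hv : ∀ a, v a = l a ∨ v a = u a) {x : N → ℝ} (hx : ∀ β₀, x ∈ hull T l u γ β₀) :
    Flip T γ v x := by
  have hr := slope_nonneg (residue_nonneg hT γ v) (residue_lt hT γ v)
  have hsum : ∀ y : N → ℝ, pairing γ y - ((∑ a, γ a * v a : ℤ) : ℝ) =
      ∑ a, (γ a : ℝ) * (y a - v a) := by
    intro y
    simp only [pairing, mul_sub, Finset.sum_sub_distrib]
    push_cast
    rfl
  refine le_of_forall_mem_hull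
    (concaveOn_sum _ (convex_box l u) fun a _ => concaveOn_hinge (hv a) hr (γ a))
    (residue_nonneg hT γ v) (residue_lt hT γ v) (dvd_residue_add T γ v) ?_ ?_ hx
  · intro y _
    rw [hsum]
    exact Finset.sum_le_sum fun a _ => le_max_left _ _
  · intro y _
    rw [hsum, Finset.mul_sum, ← Finset.sum_neg_distrib]
    exact Finset.sum_le_sum fun a _ => le_max_right _ _

/-- In one coordinate, `c` is the largest step (in the direction in which `γ c ≥ 0`) such that `x`
can be moved by `q c` one way and by `p c` the other way within `[l, u]`; the bound that is
attained is `v`. -/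
theorem exists_step {l u : ℤ} {x p q : ℝ} (hl : (l : ℝ) ≤ x) (hu : x ≤ u) (hp : 0 < p)
    (hq : 0 < q) (γ : ℤ) :
    ∃ (c : ℝ) (v : ℤ), (v = l ∨ v = u) ∧ ((l : ℝ) ≤ x + q * c ∧ x + q * c ≤ u) ∧
      ((l : ℝ) ≤ x - p * c ∧ x - p * c ≤ u) ∧
      (γ : ℝ) * c = max ((γ : ℝ) * (x - v)) 0 / p + max (-((γ : ℝ) * (x - v))) 0 / q := by
  have hxl : 0 ≤ x - l := by linarith
  have hxu : 0 ≤ u - x := by linarith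
  have e1 : ∀ y : ℝ, p * (y / p) = y := fun y => mul_div_cancel₀ y hp.ne'
  have e2 : ∀ y : ℝ, q * (y / q) = y := fun y => mul_div_cancel₀ y hq.ne'
  rcases le_total (0 : ℝ) (γ : ℝ) with hγ | hγ
  · rcases le_total ((u - x) / q) ((x - l) / p) with h | h
    · refine ⟨(u - x) / q, u, Or.inr rfl, ?_, ?_, ?_⟩
      · rw [e2]; constructor <;> linarith
      · have h1 := mul_le_mul_of_nonneg_left h hp.le
        have h2 : 0 ≤ p * ((u - x) / q) := by positivity
        rw [e1] at h1
        constructor <;> linarith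
      · have : (γ : ℝ) * (x - u) ≤ 0 := mul_nonpos_of_nonneg_of_nonpos hγ (by linarith)
        rw [max_eq_right this, max_eq_left (by linarith)]; ring
    · refine ⟨(x - l) / p, l, Or.inl rfl, ?_, ?_, ?_⟩
      · have h1 := mul_le_mul_of_nonneg_left h hq.le
        have h2 : 0 ≤ q * ((x - l) / p) := by positivity
        rw [e2] at h1
        constructor <;> linarith
      · rw [e1]; constructor <;> linarith
      · have : 0 ≤ (γ : ℝ) * (x - l) := mul_nonneg hγ hxl
        rw [max_eq_left this, max_eq_right (by linarith)]; ring
  · rcases le_total ((x - l) / q) ((u - x) / p) with h | h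
    · refine ⟨-((x - l) / q), l, Or.inl rfl, ?_, ?_, ?_⟩
      · rw [mul_neg, e2]; constructor <;> linarith
      · have h1 := mul_le_mul_of_nonneg_left h hp.le
        have h2 : 0 ≤ p * ((x - l) / q) := by positivity
        rw [e1] at h1
        rw [mul_neg]
        constructor <;> linarith
      · have : (γ : ℝ) * (x - l) ≤ 0 := mul_nonpos_of_nonpos_of_nonneg hγ hxl
        rw [max_eq_right this, max_eq_left (by linarith)]; ring
    · refine ⟨-((u - x) / p), u, Or.inr rfl, ?_, ?_, ?_⟩
      · have h1 := mul_le_mul_of_nonneg_left h hq.le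
        have h2 : 0 ≤ q * ((u - x) / p) := by positivity
        rw [e2] at h1
        rw [mul_neg]
        constructor <;> linarith
      · rw [mul_neg, e1]; constructor <;> linarith
      · have : 0 ≤ (γ : ℝ) * (x - u) := mul_nonneg_of_nonpos_of_nonpos hγ (by linarith)
        rw [max_eq_left this, max_eq_right (by linarith)]; ring

/-- A point of the box outside the hull of a disjunction violates a flip inequality at some vertex
of the box, and it does so for both orientations of the form. The vertex records which bound is
attained first, in each coordinate, by the largest segment that has the point in the ratio
prescribed by the disjunction. -/
theorem exists_not_flip {T : ℕ} {l u γ : N → ℤ} {β₀ : ℤ} {x : N → ℝ}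
    (hx : x ∈ box l u) (hn : x ∉ hull T l u γ β₀) :
    ∃ v : N → ℤ, (∀ a, v a = l a ∨ v a = u a) ∧ ¬ Flip T γ v x ∧ ¬ Flip T (-γ) v x := by
  have hlt : (T : ℝ) * β₀ < pairing γ x := by
    by_contra h
    exact hn (subset_convexHull _ _ (Or.inl ⟨hx, not_lt.mp h⟩))
  have hgt : pairing γ x < (T : ℝ) * β₀ + T := by
    by_contra h
    exact hn (subset_convexHull _ _ (Or.inr ⟨hx, not_lt.mp h⟩))
  obtain ⟨p, hp⟩ : ∃ p, p = pairing γ x - T * β₀ := ⟨_, rfl⟩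
  obtain ⟨q, hq⟩ : ∃ q, q = T - p := ⟨_, rfl⟩
  have hp0 : 0 < p := by linarith
  have hq0 : 0 < q := by linarith
  choose c v hv hc2 hc1 hcw using fun a => exists_step (hx a).1 (hx a).2 hp0 hq0 (γ a)
  set P := ∑ a, max ((γ a : ℝ) * (x a - v a)) 0 with hP
  set M := ∑ a, max (-((γ a : ℝ) * (x a - v a))) 0 with hM
  have hγc : ∑ a, (γ a : ℝ) * c a = P / p + M / q := by
    simp only [hcw, Finset.sum_add_distrib, hP, hM, Finset.sum_div]
  -- Otherwise the two points at distances `p c` and `q c` from `x` lie on opposite sides of the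
  -- disjunction, and `x` lies on the segment between them.
  have hlt1 : P / p + M / q < 1 := by
    by_contra hge
    rw [not_lt, ← hγc] at hge
    apply hn
    have h2 : (fun a => x a + q * c a) ∈ hull T l u γ β₀ := by
      refine subset_convexHull _ _ (Or.inr ⟨hc2, ?_⟩)
      have : pairing γ (fun a => x a + q * c a) = pairing γ x + q * ∑ a, (γ a : ℝ) * c a := by
        simp only [pairing, Finset.mul_sum, ← Finset.sum_add_distrib]
        exact Finset.sum_congr rfl fun a _ => by ring
      rw [this]
      nlinarith
    have h1 : (fun a => x a - p * c a) ∈ hull T l u γ β₀ := by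
      refine subset_convexHull _ _ (Or.inl ⟨hc1, ?_⟩)
      have : pairing γ (fun a => x a - p * c a) = pairing γ x - p * ∑ a, (γ a : ℝ) * c a := by
        simp only [pairing, Finset.mul_sum, ← Finset.sum_sub_distrib]
        exact Finset.sum_congr rfl fun a _ => by ring
      rw [this]
      nlinarith
    have hT : (0 : ℝ) < p + q := by linarith
    have := convex_convexHull ℝ _ h1 h2 (div_nonneg hq0.le hT.le) (div_nonneg hp0.le hT.le)
      (by field_simp; ring)
    have e : (q / (p + q)) • (fun a => x a - p * c a) + (p / (p + q)) • (fun a => x a + q * c a)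
        = x := by
      funext a
      simp only [Pi.add_apply, Pi.smul_apply, smul_eq_mul]
      field_simp
      ring
    rw [e] at this
    exact this
  have hP0 : 0 ≤ P := Finset.sum_nonneg fun a _ => le_max_right _ _
  have hM0 : 0 ≤ M := Finset.sum_nonneg fun a _ => le_max_right _ _
  have hlt2 : P * q + M * p < p * q := by
    rw [div_add_div _ _ hp0.ne' hq0.ne', div_lt_one (by positivity)] at hlt1
    linarith
  obtain ⟨n, hn'⟩ : ∃ n : ℤ, n = ∑ a, γ a * v a - T * β₀ := ⟨_, rfl⟩
  have hPM : P - M = p - n := by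
    have h1 : P - M = ∑ a, (γ a : ℝ) * (x a - v a) := by
      rw [hP, hM, ← Finset.sum_sub_distrib]
      refine Finset.sum_congr rfl fun a _ => ?_
      rcases le_total 0 ((γ a : ℝ) * (x a - v a)) with h | h
      · rw [max_eq_left h, max_eq_right (by linarith)]; ring
      · rw [max_eq_right h, max_eq_left (by linarith)]; ring
    rw [h1, hn', hp]
    push_cast
    simp only [pairing, mul_sub, Finset.sum_sub_distrib]
    ring
  have hPp : P < p := by
    by_contra h
    nlinarith
  have hMq : M < q := by
    by_contra h
    nlinarith
  have hn0 : (0 : ℝ) < n := by linarith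
  have hnT : (n : ℝ) < T := by linarith
  have hn0' : 0 < n := by exact_mod_cast hn0
  have hnT' : n < T := by exact_mod_cast hnT
  -- In terms of the integer `n` the strict inequality becomes `n P + (T - n) M < n (T - n)`.
  have key : n * P + (T - n) * M < n * (T - n) := by
    have hPe : P = M + p - n := by linarith
    have hTe : (T : ℝ) = p + q := by linarith
    rw [hPe] at hlt2
    rw [hPe, hTe]
    nlinarith
  have hres1 : residue T γ v = T - n :=
    residue_eq (m := -β₀ - 1) (by omega) (by omega) (by rw [hn']; ring)
  have hres2 : residue T (-γ) v = n := by
    refine residue_eq (m := β₀) hn0'.le hnT' ?_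
    simp only [Pi.neg_apply, neg_mul, Finset.sum_neg_distrib, neg_neg]
    linarith
  refine ⟨v, hv, ?_, ?_⟩
  · have hs : slope T (T - n) = (T - n) / n := by simp [slope]
    have hs0 : 0 ≤ slope T (T - n) := slope_nonneg (by omega) (by omega)
    rw [Flip, hres1, not_le]
    simp only [hinge_eq hs0, Finset.sum_add_distrib, ← Finset.mul_sum]
    rw [← hP, ← hM, hs]
    push_cast
    have : P + (T - n) / n * M = (n * P + (T - n) * M) / n := by field_simp
    rw [this, div_lt_iff₀ hn0]
    linarith
  · have hs : slope T n = n / (T - n) := rfl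
    have hs0 : 0 ≤ slope T n := slope_nonneg (by omega) (by omega)
    rw [Flip, hres2, not_le]
    simp only [hinge_eq hs0, Finset.sum_add_distrib, ← Finset.mul_sum, Pi.neg_apply,
      Int.cast_neg, neg_mul, neg_neg]
    rw [← hP, ← hM, hs]
    have hTn : (0 : ℝ) < T - n := by linarith
    have : M + n / (T - n) * P = (n * P + (T - n) * M) / (T - n) := by field_simp; ring
    rw [this, div_lt_iff₀ hTn]
    linarith

end BoxSplit

namespace BoxSplit

variable {N : Type*} [Fintype N]

/-! ### Lifting along coordinates of width `T - 1` -/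

/-- The forms in `D` that involve only coordinates in `S`. -/
def supported (D : Submodule ℤ (N → ℤ)) (S : Set N) : Set (N → ℤ) :=
  {γ | γ ∈ D ∧ ∀ a, a ∉ S → γ a = 0}

variable [DecidableEq N]

/-- The left-hand side of a flip inequality without the term of the coordinate `s`. -/
noncomputable def partialFlip (T : ℕ) (s : N) (γ v : N → ℤ) (x : N → ℝ) : ℝ :=
  ∑ a ∈ Finset.univ.erase s, hinge (slope T (residue T γ v)) ((γ a : ℝ) * (x a - v a))

theorem flip_update_iff (T : ℕ) (s : N) (γ v : N → ℤ) (x : N → ℝ) (y : ℝ) :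
    Flip T γ v (Function.update x s y) ↔
      (residue T γ v : ℝ) ≤ hinge (slope T (residue T γ v)) ((γ s : ℝ) * (y - v s)) +
        partialFlip T s γ v x := by
  rw [Flip, ← Finset.add_sum_erase _ _ (Finset.mem_univ s), Function.update_self, partialFlip]
  have : ∀ a ∈ Finset.univ.erase s, Function.update x s y a = x a := fun a ha =>
    Function.update_of_ne (Finset.ne_of_mem_erase ha) _ _
  rw [Finset.sum_congr rfl fun a ha => by rw [this a ha]]

theorem partialFlip_nonneg {T : ℕ} (hT : 0 < T) (s : N) (γ v : N → ℤ) (x : N → ℝ) :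
    0 ≤ partialFlip T s γ v x :=
  Finset.sum_nonneg fun _ _ => hinge_nonneg (slope_nonneg (residue_nonneg hT γ v)
    (residue_lt hT γ v)) _

/-- The right-hand side left after eliminating a coordinate of width `T - 1` from two flip
inequalities is at most both residues whenever it is positive. Positivity forces `k₁ = 1` or
`k₂ = 1`, because `k₁ + k₂ ≤ k₁ k₂` otherwise. -/
theorem combined_residue {T k₁ k₂ α₁ α₂ : ℤ} (hk₁ : 0 < k₁) (hk₂ : 0 < k₂) (h₁ : α₁ < T)
    (h₂ : α₂ < T) (h0 : 0 < T)
    (hpos : 0 < k₂ * α₁ + k₁ * α₂ - k₁ * k₂ * (T - 1)) :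
    k₂ * α₁ + k₁ * α₂ - k₁ * k₂ * (T - 1) ≤ α₁ ∧
      k₂ * α₁ + k₁ * α₂ - k₁ * k₂ * (T - 1) ≤ α₂ := by
  rcases (show k₁ = 1 ∨ 2 ≤ k₁ by omega) with rfl | hk₁'
  · constructor
    · nlinarith [mul_nonneg (show 0 ≤ k₂ - 1 by omega) (show 0 ≤ T - 1 - α₁ by omega)]
    · nlinarith [mul_nonneg hk₂.le (show 0 ≤ T - 1 - α₁ by omega)]
  rcases (show k₂ = 1 ∨ 2 ≤ k₂ by omega) with rfl | hk₂'
  · constructor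
    · nlinarith [mul_nonneg hk₁.le (show 0 ≤ T - 1 - α₂ by omega)]
    · nlinarith [mul_nonneg (show 0 ≤ k₁ - 1 by omega) (show 0 ≤ T - 1 - α₂ by omega)]
  · exfalso
    have e1 := mul_nonneg hk₂.le (show 0 ≤ T - 1 - α₁ by omega)
    have e2 := mul_nonneg hk₁.le (show 0 ≤ T - 1 - α₂ by omega)
    have e3 : k₁ + k₂ ≤ k₁ * k₂ := by nlinarith
    have e4 := mul_le_mul_of_nonneg_right e3 (show 0 ≤ T - 1 by omega)
    nlinarith

/-- Compatibility of a lower and an upper bound on a new coordinate `s`. The lower bound comes from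
the flip inequality of `γ₁`, whose coefficient at `s` is `k₁`, the upper bound from that of `γ₂`,
whose coefficient is `-k₂`. Eliminating `s` leaves the form `η = k₂ γ₁ + k₁ γ₂`. With both
slopes lowered to a common value, the left-hand side of the combined inequality is affine on the
box and bounded below by the right-hand side on both sides of a disjunction for `η`,
although the inequality need not be a flip inequality of `η`. -/
theorem partialFlip_compatible {T : ℕ} (hT : 0 < T) {l u : N → ℤ} {D : Submodule ℤ (N → ℤ)}
    {S : Set N} {s : N} (hw : u s - l s = (T : ℤ) - 1) {x : N → ℝ}
    (hx : x ∈ region T l u (supported D S)) {γ₁ γ₂ v₁ v₂ : N → ℤ}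
    (hγ₁ : γ₁ ∈ supported D (insert s S)) (hγ₂ : γ₂ ∈ supported D (insert s S))
    (hv₁ : ∀ a, v₁ a = l a ∨ v₁ a = u a) (hv₂ : ∀ a, v₂ a = l a ∨ v₂ a = u a)
    {k₁ k₂ : ℤ} (hk₁ : 0 < k₁) (hk₂ : 0 < k₂) (hs₁ : γ₁ s = k₁) (hs₂ : γ₂ s = -k₂)
    (hl : v₁ s = l s) (hu : v₂ s = u s) :
    (k₂ : ℝ) * (residue T γ₁ v₁ - partialFlip T s γ₁ v₁ x) +
      k₁ * (residue T γ₂ v₂ - partialFlip T s γ₂ v₂ x) ≤ k₁ * k₂ * (T - 1) := by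
  have hk₁' : (0 : ℝ) < k₁ := by exact_mod_cast hk₁
  have hk₂' : (0 : ℝ) < k₂ := by exact_mod_cast hk₂
  have hR₁ := mul_nonneg hk₂'.le (partialFlip_nonneg hT s γ₁ v₁ x)
  have hR₂ := mul_nonneg hk₁'.le (partialFlip_nonneg hT s γ₂ v₂ x)
  obtain ⟨α, hα⟩ : ∃ α, α = k₂ * residue T γ₁ v₁ + k₁ * residue T γ₂ v₂ - k₁ * k₂ * (T - 1) :=
    ⟨_, rfl⟩
  have hα' : (α : ℝ) = k₂ * residue T γ₁ v₁ + k₁ * residue T γ₂ v₂ - k₁ * k₂ * (T - 1) := by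
    rw [hα]; push_cast; ring
  rcases le_or_gt α 0 with hneg | hpos
  · have : (α : ℝ) ≤ 0 := by exact_mod_cast hneg
    linarith
  have hlt₁ := residue_lt hT γ₁ v₁
  have hlt₂ := residue_lt hT γ₂ v₂
  obtain ⟨hle₁, hle₂⟩ :=
    combined_residue hk₁ hk₂ hlt₁ hlt₂ (by omega) (by rw [← hα]; exact hpos)
  rw [← hα] at hle₁ hle₂
  have hr := slope_nonneg hpos.le (hle₁.trans_lt hlt₁)
  -- As `slope T` is monotone, the slope `r` is at most the slopes of both flip inequalities and
  -- can replace them in a lower estimate.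
  set r := slope T α
  have hm₁ : r ≤ slope T (residue T γ₁ v₁) := slope_mono hpos.le hle₁ hlt₁
  have hm₂ : r ≤ slope T (residue T γ₂ v₂) := slope_mono hpos.le hle₂ hlt₂
  obtain ⟨η, hη⟩ : ∃ η, η = k₂ • γ₁ + k₁ • γ₂ := ⟨_, rfl⟩
  have hηa : ∀ a, η a = k₂ * γ₁ a + k₁ * γ₂ a := fun a => by simp [hη]
  have hηs : η s = 0 := by rw [hηa, hs₁, hs₂]; ring
  have hηD : η ∈ supported D S := by
    refine ⟨hη ▸ D.add_mem (D.smul_mem _ hγ₁.1) (D.smul_mem _ hγ₂.1), fun a ha => ?_⟩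
    by_cases has : a = s
    · rw [has, hηs]
    · have : a ∉ insert s S := by simp [has, ha]
      rw [hηa, hγ₁.2 a this, hγ₂.2 a this]; ring
  set E := Finset.univ.erase s
  obtain ⟨c, hc⟩ : ∃ c, c = ∑ a ∈ E, (k₂ * (γ₁ a * v₁ a) + k₁ * (γ₂ a * v₂ a)) := ⟨_, rfl⟩
  have hdvd : (T : ℤ) ∣ α + c := by
    have h := dvd_add ((dvd_residue_add T γ₁ v₁).mul_left k₂)
      ((dvd_residue_add T γ₂ v₂).mul_left k₁)
    rw [← Finset.add_sum_erase _ _ (Finset.mem_univ s),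
      ← Finset.add_sum_erase _ (fun a => γ₂ a * v₂ a) (Finset.mem_univ s), hs₁, hs₂, hl, hu] at h
    refine h.trans (dvd_of_eq ?_)
    rw [hc, hα, ← hw, Finset.sum_add_distrib, ← Finset.mul_sum, ← Finset.mul_sum]
    ring
  have hsum : ∀ y, pairing η y - c =
      ∑ a ∈ E, ((k₂ : ℝ) * (γ₁ a * (y a - v₁ a)) + k₁ * (γ₂ a * (y a - v₂ a))) := by
    intro y
    rw [pairing, ← Finset.add_sum_erase _ _ (Finset.mem_univ s), hηs, hc]
    push_cast
    rw [zero_mul, zero_add, ← Finset.sum_sub_distrib]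
    refine Finset.sum_congr rfl fun a _ => ?_
    rw [hηa]; push_cast; ring
  have hmain : (α : ℝ) ≤ ∑ a ∈ E, ((k₂ : ℝ) * hinge r ((γ₁ a : ℝ) * (x a - v₁ a)) +
      k₁ * hinge r ((γ₂ a : ℝ) * (x a - v₂ a))) := by
    refine le_of_forall_mem_hull (Φ := fun x => ∑ a ∈ E,
      ((k₂ : ℝ) * hinge r ((γ₁ a : ℝ) * (x a - v₁ a)) +
        k₁ * hinge r ((γ₂ a : ℝ) * (x a - v₂ a))))
      (concaveOn_sum _ (convex_box l u) fun a _ => ?_) hpos.le (hle₁.trans_lt hlt₁) hdvd ?_ ?_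
      (hx.2 η hηD)
    · exact ((concaveOn_hinge (hv₁ a) hr (γ₁ a)).smul hk₂'.le).add
        ((concaveOn_hinge (hv₂ a) hr (γ₂ a)).smul hk₁'.le)
    · intro y _
      rw [hsum]
      exact Finset.sum_le_sum fun a _ => add_le_add
        (mul_le_mul_of_nonneg_left (le_max_left _ _) hk₂'.le)
        (mul_le_mul_of_nonneg_left (le_max_left _ _) hk₁'.le)
    · intro y _
      rw [hsum, Finset.mul_sum, ← Finset.sum_neg_distrib]
      refine Finset.sum_le_sum fun a _ => ?_
      have e1 := mul_le_mul_of_nonneg_left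
        (le_max_right ((γ₁ a : ℝ) * (y a - v₁ a)) (-(r * ((γ₁ a : ℝ) * (y a - v₁ a))))) hk₂'.le
      have e2 := mul_le_mul_of_nonneg_left
        (le_max_right ((γ₂ a : ℝ) * (y a - v₂ a)) (-(r * ((γ₂ a : ℝ) * (y a - v₂ a))))) hk₁'.le
      unfold hinge
      linarith
  have hup : ∑ a ∈ E, ((k₂ : ℝ) * hinge r ((γ₁ a : ℝ) * (x a - v₁ a)) +
      k₁ * hinge r ((γ₂ a : ℝ) * (x a - v₂ a))) ≤
        k₂ * partialFlip T s γ₁ v₁ x + k₁ * partialFlip T s γ₂ v₂ x := by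
    rw [partialFlip, partialFlip, Finset.mul_sum, Finset.mul_sum, ← Finset.sum_add_distrib]
    exact Finset.sum_le_sum fun a _ => add_le_add
      (mul_le_mul_of_nonneg_left (hinge_mono hr hm₁ _) hk₂'.le)
      (mul_le_mul_of_nonneg_left (hinge_mono hr hm₂ _) hk₁'.le)
  linarith

/-- The flip inequalities bound a new coordinate of width `T - 1` by compatible lower and upper
bounds, so some value satisfies all of them. -/
theorem exists_update_mem_region {T : ℕ} (hT : 0 < T) {l u : N → ℤ} {D : Submodule ℤ (N → ℤ)}
    {S : Set N} {s : N} (hw : u s - l s = (T : ℤ) - 1) {x : N → ℝ}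
    (hx : x ∈ region T l u (supported D S)) :
    ∃ y, Function.update x s y ∈ region T l u (supported D (insert s S)) := by
  have hw' : (u s : ℝ) - l s = T - 1 := by exact_mod_cast hw
  have hT1 : (1 : ℝ) ≤ T := by exact_mod_cast hT
  have hres : ∀ γ v : N → ℤ, (residue T γ v : ℝ) - partialFlip T s γ v x ≤ T - 1 := by
    intro γ v
    have h1 := partialFlip_nonneg hT s γ v x
    have h2 : (residue T γ v : ℝ) ≤ T - 1 := by
      have := residue_lt hT γ v
      exact_mod_cast (show residue T γ v ≤ (T : ℤ) - 1 by omega)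
    linarith
  have hres' : ∀ (γ v : N → ℤ) (k : ℤ), 0 < k →
      ((residue T γ v : ℝ) - partialFlip T s γ v x) / k ≤ T - 1 := by
    intro γ v k hk
    have hk' : (1 : ℝ) ≤ k := by exact_mod_cast hk
    rw [div_le_iff₀ (by linarith)]
    nlinarith [hres γ v]
  set L : Set ℝ := {y | y = l s ∨ ∃ γ ∈ supported D (insert s S), ∃ v : N → ℤ,
    (∀ a, v a = l a ∨ v a = u a) ∧ 0 < γ s ∧ v s = l s ∧
      y = l s + (residue T γ v - partialFlip T s γ v x) / (γ s : ℤ)} with hL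
  set R : Set ℝ := {y | y = u s ∨ ∃ γ ∈ supported D (insert s S), ∃ v : N → ℤ,
    (∀ a, v a = l a ∨ v a = u a) ∧ 0 < -γ s ∧ v s = u s ∧
      y = u s - (residue T γ v - partialFlip T s γ v x) / (-γ s : ℤ)} with hR
  have hLR : ∀ y ∈ L, ∀ z ∈ R, y ≤ z := by
    rintro y (rfl | ⟨γ₁, hγ₁, v₁, hv₁, hk₁, hl, rfl⟩) z
      (rfl | ⟨γ₂, hγ₂, v₂, hv₂, hk₂, hu, rfl⟩)
    · linarith
    · have := hres' γ₂ v₂ _ hk₂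
      linarith
    · have := hres' γ₁ v₁ _ hk₁
      linarith
    · have h := partialFlip_compatible hT hw hx hγ₁ hγ₂ hv₁ hv₂ hk₁ hk₂ rfl (by ring) hl hu
      have hk₁' : (0 : ℝ) < (γ₁ s : ℤ) := by exact_mod_cast hk₁
      have hk₂' : (0 : ℝ) < (-γ₂ s : ℤ) := by exact_mod_cast hk₂
      have hdiv : ((residue T γ₁ v₁ : ℝ) - partialFlip T s γ₁ v₁ x) / (γ₁ s : ℤ) +
          ((residue T γ₂ v₂ : ℝ) - partialFlip T s γ₂ v₂ x) / (-γ₂ s : ℤ) ≤ T - 1 := by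
        rw [div_add_div _ _ hk₁'.ne' hk₂'.ne', div_le_iff₀ (mul_pos hk₁' hk₂')]
        linarith
      linarith
  have hlL : (l s : ℝ) ∈ L := Or.inl rfl
  have huR : (u s : ℝ) ∈ R := Or.inl rfl
  have hbdd : BddAbove L := ⟨u s, fun y hy => hLR y hy _ huR⟩
  obtain ⟨y, hyL, hyR⟩ : ∃ y, (∀ z ∈ L, z ≤ y) ∧ ∀ z ∈ R, y ≤ z :=
    ⟨sSup L, fun z hz => le_csSup hbdd hz, fun z hz => csSup_le ⟨_, hlL⟩ fun t ht => hLR t ht z hz⟩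
  have hbox : Function.update x s y ∈ box l u := by
    intro a
    by_cases ha : a = s
    · subst ha
      rw [Function.update_self]
      exact ⟨hyL _ hlL, hyR _ huR⟩
    · rw [Function.update_of_ne ha]
      exact hx.1 a
  have hflip : ∀ γ ∈ supported D (insert s S), ∀ v : N → ℤ, (∀ a, v a = l a ∨ v a = u a) →
      (0 < γ s ∧ v s = l s ∨ 0 < -γ s ∧ v s = u s) → Flip T γ v (Function.update x s y) := by
    rintro γ hγ v hv (⟨hk, hvs⟩ | ⟨hk, hvs⟩)
    · have h := hyL _ (Or.inr ⟨γ, hγ, v, hv, hk, hvs, rfl⟩)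
      have hk' : (0 : ℝ) < γ s := by exact_mod_cast hk
      rw [← le_sub_iff_add_le', div_le_iff₀ hk'] at h
      rw [flip_update_iff, hvs]
      have := le_max_left ((γ s : ℝ) * (y - l s))
        (-(slope T (residue T γ v) * ((γ s : ℝ) * (y - l s))))
      unfold hinge
      linarith
    · have h := hyR _ (Or.inr ⟨γ, hγ, v, hv, hk, hvs, rfl⟩)
      have hk' : (0 : ℝ) < (-γ s : ℤ) := by exact_mod_cast hk
      rw [le_sub_comm, div_le_iff₀ hk'] at h
      push_cast at h
      rw [flip_update_iff, hvs]
      have := le_max_left ((γ s : ℝ) * (y - u s))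
        (-(slope T (residue T γ v) * ((γ s : ℝ) * (y - u s))))
      unfold hinge
      linarith
  refine ⟨y, hbox, fun γ hγ β₀ => ?_⟩
  by_contra hn
  obtain ⟨v, hv, hn₁, hn₂⟩ := exists_not_flip hbox hn
  rcases lt_trichotomy (γ s) 0 with hk | hk | hk
  · rcases hv s with hvs | hvs
    · refine hn₂ (hflip (-γ) ⟨D.neg_mem hγ.1, fun a ha => ?_⟩ v hv (Or.inl ⟨?_, hvs⟩))
      · simp [hγ.2 a ha]
      · simpa using hk
    · exact hn₁ (hflip γ hγ v hv (Or.inr ⟨by omega, hvs⟩))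
  · have hγ' : γ ∈ supported D S := by
      refine ⟨hγ.1, fun a ha => ?_⟩
      by_cases has : a = s
      · rw [has, hk]
      · exact hγ.2 a (by simp [has, ha])
    have h := flip_of_forall_mem_hull hT hv (hx.2 γ hγ')
    rw [← Function.update_eq_self s x, flip_update_iff] at h
    refine hn₁ ((flip_update_iff ..).2 ?_)
    simpa [hk] using h
  · rcases hv s with hvs | hvs
    · exact hn₁ (hflip γ hγ v hv (Or.inl ⟨hk, hvs⟩))
    · refine hn₂ (hflip (-γ) ⟨D.neg_mem hγ.1, fun a ha => ?_⟩ v hv (Or.inr ⟨?_, hvs⟩))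
      · simp [hγ.2 a ha]
      · simpa using hk

/-- Iteration of `exists_update_mem_region` over all coordinates outside `S`. -/
theorem exists_extension_mem_region {T : ℕ} (hT : 0 < T) {l u : N → ℤ}
    {D : Submodule ℤ (N → ℤ)} {S : Set N} (hw : ∀ s, s ∉ S → u s - l s = (T : ℤ) - 1)
    {x : N → ℝ} (hx : x ∈ region T l u (supported D S)) :
    ∃ x' ∈ region T l u (D : Set (N → ℤ)), ∀ a ∈ S, x' a = x a := by
  have key : ∀ W : Finset N, ∃ x' ∈ region T l u (supported D (S ∪ W)), ∀ a ∈ S, x' a = x a := by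
    intro W
    induction W using Finset.induction_on with
    | empty => exact ⟨x, by simpa using hx, fun _ _ => rfl⟩
    | insert s W _ ih =>
      obtain ⟨x', hx', he⟩ := ih
      rw [Finset.coe_insert, Set.union_insert]
      by_cases hs : s ∈ S
      · rw [Set.insert_eq_of_mem (Set.mem_union_left _ hs)]
        exact ⟨x', hx', he⟩
      · obtain ⟨y, hy⟩ := exists_update_mem_region hT (hw s hs) hx'
        refine ⟨_, hy, fun a ha => ?_⟩
        rw [Function.update_of_ne (by rintro rfl; exact hs ha), he a ha]
  obtain ⟨x', hx', he⟩ := key Finset.univ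
  refine ⟨x', ⟨hx'.1, fun γ hγ => hx'.2 γ ⟨hγ, fun a ha => ?_⟩⟩, he⟩
  simp at ha

end BoxSplit

namespace BoxSplit

/-! ### Projections of split regions -/

theorem pairing_extend {A N : Type*} [Fintype A] [Fintype N] {e : A → N}
    (he : Function.Injective e) (γ : A → ℤ) (x : N → ℝ) :
    pairing (Function.extend e γ 0) x = pairing γ (x ∘ e) := by
  refine (Fintype.sum_of_injective e he _ _ ?_ ?_).symm
  · intro n hn
    rw [Function.extend_apply' _ _ _ (by simpa using hn)]
    simp
  · intro a
    rw [he.extend_apply, Function.comp_apply]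

theorem extend_comp_eq {A N : Type*} {e : A → N} (he : Function.Injective e) {γ : N → ℤ}
    (h : ∀ n, n ∉ Set.range e → γ n = 0) : Function.extend e (γ ∘ e) 0 = γ := by
  funext n
  by_cases hn : n ∈ Set.range e
  · obtain ⟨a, rfl⟩ := hn
    rw [he.extend_apply, Function.comp_apply]
  · rw [Function.extend_apply' _ _ _ (by simpa using hn), h n hn, Pi.zero_apply]

theorem comp_mem_hull {A N : Type*} [Fintype A] [Fintype N] {T : ℕ} {e : A → N}
    (he : Function.Injective e) {l u : N → ℤ} {γ : A → ℤ} {β₀ : ℤ} {x : N → ℝ}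
    (hx : x ∈ hull T l u (Function.extend e γ 0) β₀) :
    x ∘ e ∈ hull T (l ∘ e) (u ∘ e) γ β₀ := by
  have hconv : Convex ℝ {x : N → ℝ | x ∘ e ∈ hull T (l ∘ e) (u ∘ e) γ β₀} :=
    (convex_convexHull ℝ _).linear_preimage (LinearMap.funLeft ℝ ℝ e)
  refine convexHull_min ?_ hconv hx
  rintro y (⟨hy, h⟩ | ⟨hy, h⟩) <;> rw [pairing_extend he] at h
  · exact subset_convexHull _ _ (Or.inl ⟨fun a => hy (e a), h⟩)
  · exact subset_convexHull _ _ (Or.inr ⟨fun a => hy (e a), h⟩)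

theorem extend_mem_hull {A N : Type*} [Fintype A] [Fintype N] {T : ℕ} {e : A → N}
    (he : Function.Injective e) {l u : N → ℤ} (hlu : ∀ n, n ∉ Set.range e → l n ≤ u n)
    {γ : A → ℤ} {β₀ : ℤ} {x : A → ℝ} (hx : x ∈ hull T (l ∘ e) (u ∘ e) γ β₀) :
    Function.extend e x (fun n => (l n : ℝ)) ∈ hull T l u (Function.extend e γ 0) β₀ := by
  have hcomp : ∀ y : A → ℝ, Function.extend e y (fun n => (l n : ℝ)) ∘ e = y := fun y =>
    Function.extend_comp he _ _
  have hbox : ∀ y ∈ box (l ∘ e) (u ∘ e), Function.extend e y (fun n => (l n : ℝ)) ∈ box l u := by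
    intro y hy n
    by_cases hn : n ∈ Set.range e
    · obtain ⟨a, rfl⟩ := hn
      rw [he.extend_apply]
      exact hy a
    · rw [Function.extend_apply' _ _ _ (by simpa using hn)]
      exact ⟨le_rfl, by exact_mod_cast hlu n hn⟩
  have hconv : Convex ℝ {y : A → ℝ | Function.extend e y (fun n => (l n : ℝ)) ∈
      hull T l u (Function.extend e γ 0) β₀} := by
    intro y hy z hz p q hp hq hpq
    have := convex_convexHull ℝ _ hy hz hp hq hpq
    refine (congrArg (· ∈ hull T l u (Function.extend e γ 0) β₀) ?_).mpr this
    funext n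
    simp only [Pi.add_apply, Pi.smul_apply, smul_eq_mul]
    by_cases hn : n ∈ Set.range e
    · obtain ⟨a, rfl⟩ := hn
      simp [he.extend_apply]
    · simp only [Function.extend_apply' _ _ _ (show ¬ ∃ a, e a = n by simpa using hn)]
      rw [← add_mul, hpq, one_mul]
  refine convexHull_min ?_ hconv hx
  rintro y (⟨hy, h⟩ | ⟨hy, h⟩)
  · exact subset_convexHull _ _ (Or.inl ⟨hbox y hy, by rwa [pairing_extend he, hcomp]⟩)
  · exact subset_convexHull _ _ (Or.inr ⟨hbox y hy, by rwa [pairing_extend he, hcomp]⟩)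

theorem comp_mem_region {A N : Type*} [Fintype A] [Fintype N] {T : ℕ} {e : A → N}
    (he : Function.Injective e) {l u : N → ℤ} {D : Set (N → ℤ)} {x : N → ℝ}
    (hx : x ∈ region T l u D) :
    x ∘ e ∈ region T (l ∘ e) (u ∘ e) {γ : A → ℤ | Function.extend e γ 0 ∈ D} :=
  ⟨fun a => hx.1 (e a), fun _ hγ β₀ => comp_mem_hull he (hx.2 _ hγ β₀)⟩

theorem exists_comp_eq_of_mem_region {A N : Type*} [Fintype A] [Fintype N] {T : ℕ} (hT : 0 < T)
    {e : A → N} (he : Function.Injective e) {l u : N → ℤ}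
    (hw : ∀ n, n ∉ Set.range e → u n - l n = (T : ℤ) - 1) (D : Submodule ℤ (N → ℤ)) {x : A → ℝ}
    (hx : x ∈ region T (l ∘ e) (u ∘ e) {γ : A → ℤ | Function.extend e γ 0 ∈ D}) :
    ∃ x' ∈ region T l u (D : Set (N → ℤ)), x' ∘ e = x := by
  classical
  have hlu : ∀ n, n ∉ Set.range e → l n ≤ u n := fun n hn => by
    have := hw n hn
    omega
  have hx₀ : Function.extend e x (fun n => (l n : ℝ)) ∈
      region T l u (supported D (Set.range e)) := by
    refine ⟨fun n => ?_, fun γ hγ β₀ => ?_⟩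
    · by_cases hn : n ∈ Set.range e
      · obtain ⟨a, rfl⟩ := hn
        rw [he.extend_apply]
        exact hx.1 a
      · rw [Function.extend_apply' _ _ _ (by simpa using hn)]
        exact ⟨le_rfl, by exact_mod_cast hlu n hn⟩
    · have hγe := extend_comp_eq he hγ.2
      have := extend_mem_hull he hlu
        (hx.2 (γ ∘ e) (show Function.extend e (γ ∘ e) 0 ∈ D by rw [hγe]; exact hγ.1) β₀)
      rwa [hγe] at this
  obtain ⟨x', hx', h⟩ := exists_extension_mem_region hT hw hx₀
  refine ⟨x', hx', funext fun a => ?_⟩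
  rw [Function.comp_apply, h _ ⟨a, rfl⟩, he.extend_apply]

/-! ### Relaxations with integer variables determined by the continuous ones -/

/-- The polyhedron `M x = T z`, `l ≤ x ≤ u` with continuous variables `x` and integer
variables `z`. -/
def relaxation {N P : Type*} [Fintype N] (T : ℕ) (l u : N → ℤ) (M : Matrix P N ℤ) :
    Set ((N → ℝ) × (P → ℝ)) :=
  {q | (∀ k, ∑ a, (M k a : ℝ) * q.1 a = (T : ℝ) * q.2 k) ∧
    ∀ a, (l a : ℝ) ≤ q.1 a ∧ q.1 a ≤ (u a : ℝ)}

/-- The linear map `x ↦ (x, T⁻¹ M x)`. -/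
noncomputable def graphMap {N P : Type*} [Fintype N] (T : ℕ) (M : Matrix P N ℤ) :
    (N → ℝ) →ₗ[ℝ] (N → ℝ) × (P → ℝ) :=
  LinearMap.prod LinearMap.id ((T : ℝ)⁻¹ • (M.map (Int.cast : ℤ → ℝ)).mulVecLin)

theorem graphMap_apply {N P : Type*} [Fintype N] (T : ℕ) (M : Matrix P N ℤ) (x : N → ℝ) :
    graphMap T M x = (x, fun k => (T : ℝ)⁻¹ * ∑ a, (M k a : ℝ) * x a) :=
  rfl

theorem eq_graphMap_iff {N P : Type*} [Fintype N] {T : ℕ} (hT : 0 < T) {M : Matrix P N ℤ}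
    {q : (N → ℝ) × (P → ℝ)} :
    graphMap T M q.1 = q ↔ ∀ k, ∑ a, (M k a : ℝ) * q.1 a = (T : ℝ) * q.2 k := by
  have hT' : (T : ℝ) ≠ 0 := by exact_mod_cast hT.ne'
  rw [graphMap_apply, Prod.ext_iff]
  simp only [true_and, funext_iff]
  refine forall_congr' fun k => ?_
  rw [inv_mul_eq_iff_eq_mul₀ hT']

theorem splitHull_relaxation {N P : Type*} [Fintype N] [Fintype P] {T : ℕ} (hT : 0 < T)
    (l u : N → ℤ) (M : Matrix P N ℤ) (β : P → ℤ) (β₀ : ℤ) :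
    splitHull (relaxation T l u M) β β₀ = graphMap T M '' hull T l u (∑ k, β k • M k) β₀ := by
  have hT' : (0 : ℝ) < T := by exact_mod_cast hT
  have hsum : ∀ q ∈ relaxation T l u M,
      pairing (∑ k, β k • M k) q.1 = T * ∑ k, (β k : ℝ) * q.2 k := by
    intro q hq
    simp only [pairing, Finset.sum_apply, Pi.smul_apply, smul_eq_mul, Int.cast_sum, Int.cast_mul,
      Finset.sum_mul, Finset.mul_sum]
    rw [Finset.sum_comm]
    refine Finset.sum_congr rfl fun k _ => ?_
    have := hq.1 k
    rw [show (T : ℝ) * (β k * q.2 k) = β k * (T * q.2 k) by ring, ← this, Finset.mul_sum]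
    exact Finset.sum_congr rfl fun a _ => by ring
  have hmem : ∀ x ∈ box l u, graphMap T M x ∈ relaxation T l u M := fun x hx =>
    ⟨(eq_graphMap_iff hT (q := graphMap T M x)).1 rfl, hx⟩
  rw [splitHull, hull, LinearMap.image_convexHull]
  congr 1
  ext q
  constructor
  · rintro (⟨hq, h⟩ | ⟨hq, h⟩)
    · refine ⟨q.1, Or.inl ⟨hq.2, ?_⟩, (eq_graphMap_iff hT).2 hq.1⟩
      rw [hsum q hq]
      exact mul_le_mul_of_nonneg_left h hT'.le
    · refine ⟨q.1, Or.inr ⟨hq.2, ?_⟩, (eq_graphMap_iff hT).2 hq.1⟩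
      rw [hsum q hq]
      have := mul_le_mul_of_nonneg_left h hT'.le
      linarith
  · rintro ⟨x, ⟨hx, h⟩ | ⟨hx, h⟩, rfl⟩
    · refine Or.inl ⟨hmem x hx, ?_⟩
      have e := hsum _ (hmem x hx)
      rw [graphMap_apply] at e ⊢
      rw [e] at h
      exact le_of_mul_le_mul_left h hT'
    · refine Or.inr ⟨hmem x hx, ?_⟩
      have e := hsum _ (hmem x hx)
      rw [graphMap_apply] at e ⊢
      rw [e] at h
      exact le_of_mul_le_mul_left (by linarith) hT'

theorem mem_splitClosure_relaxation {N P : Type*} [Fintype N] [Fintype P] {T : ℕ} (hT : 0 < T)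
    (l u : N → ℤ) (M : Matrix P N ℤ) (q : (N → ℝ) × (P → ℝ)) :
    q ∈ splitClosure (relaxation T l u M) ↔
      (∀ k, ∑ a, (M k a : ℝ) * q.1 a = (T : ℝ) * q.2 k) ∧
        q.1 ∈ region T l u (Submodule.span ℤ (Set.range fun k => M k)) := by
  simp only [splitClosure, Set.mem_iInter, splitHull_relaxation hT]
  rw [← eq_graphMap_iff hT]
  constructor
  · intro h
    have hq : graphMap T M q.1 = q := by
      obtain ⟨x, _, rfl⟩ := h 0 0
      rfl
    have hin : ∀ (β : P → ℤ) (β₀ : ℤ), q.1 ∈ hull T l u (∑ k, β k • M k) β₀ := by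
      intro β β₀
      obtain ⟨x, hx, rfl⟩ := h β β₀
      exact hx
    refine ⟨hq, ?_, fun γ hγ β₀ => ?_⟩
    · exact convexHull_min (Set.union_subset (fun _ h => h.1) fun _ h => h.1) (convex_box l u)
        (hin 0 0)
    · obtain ⟨β, rfl⟩ := (Submodule.mem_span_range_iff_exists_fun ℤ).1 hγ
      exact hin β β₀
  · rintro ⟨hq, -, h⟩ β β₀
    exact ⟨q.1, h _ ((Submodule.mem_span_range_iff_exists_fun ℤ).2 ⟨β, rfl⟩) β₀, hq⟩

/-- The split closure of a relaxation with additional variables of width `T - 1` projects onto the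
split closure of the original relaxation, provided that the row lattice of the original matrix is
the part of the larger row lattice that is supported on the original variables. -/
theorem image_splitClosure_relaxation {A N P Q : Type*} [Fintype A] [Fintype N] [Fintype P]
    [Fintype Q] {T : ℕ} (hT : 0 < T) {e : A → N} (he : Function.Injective e) {l u : N → ℤ}
    (hw : ∀ n, n ∉ Set.range e → u n - l n = (T : ℤ) - 1) {M : Matrix P A ℤ} {M' : Matrix Q N ℤ}
    {U : Matrix P Q ℤ} (hU : IsTransitionMatrix e M M' U)
    (hD : ∀ γ : A → ℤ, Function.extend e γ 0 ∈ Submodule.span ℤ (Set.range fun k => M' k) →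
      γ ∈ Submodule.span ℤ (Set.range fun k => M k)) :
    Set.MapsTo (transitionProj e U) (relaxation T l u M') (relaxation T (l ∘ e) (u ∘ e) M) ∧
      transitionProj e U '' splitClosure (relaxation T l u M') =
        splitClosure (relaxation T (l ∘ e) (u ∘ e) M) := by
  have hrow : ∀ b (x : N → ℝ), ∑ a, (M b a : ℝ) * x (e a) =
      ∑ k, (U b k : ℝ) * ∑ n, (M' k n : ℝ) * x n := by
    intro b x
    have h := pairing_extend he (M b) x
    rw [← hU b] at h
    refine h.symm.trans ?_
    simp only [pairing, Matrix.mul_apply, Int.cast_sum, Int.cast_mul, Finset.sum_mul,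
      Finset.mul_sum]
    rw [Finset.sum_comm]
    exact Finset.sum_congr rfl fun k _ => Finset.sum_congr rfl fun n _ => by ring
  have heq : ∀ q : (N → ℝ) × (Q → ℝ), (∀ k, ∑ n, (M' k n : ℝ) * q.1 n = (T : ℝ) * q.2 k) →
      ∀ b, ∑ a, (M b a : ℝ) * q.1 (e a) = (T : ℝ) * ∑ k, (U b k : ℝ) * q.2 k := by
    intro q hq b
    rw [hrow, Finset.mul_sum]
    exact Finset.sum_congr rfl fun k _ => by rw [hq]; ring
  have hD' : {γ : A → ℤ | Function.extend e γ 0 ∈ Submodule.span ℤ (Set.range fun k => M' k)} =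
      (Submodule.span ℤ (Set.range fun k => M k) : Set (A → ℤ)) := by
    refine Set.Subset.antisymm hD ?_
    have : Submodule.span ℤ (Set.range fun k => M k) ≤
        (Submodule.span ℤ (Set.range fun k => M' k)).comap
          (Function.ExtendByZero.linearMap ℤ e) := by
      rw [Submodule.span_le]
      rintro _ ⟨b, rfl⟩
      change Function.extend e (M b) 0 ∈ Submodule.span ℤ (Set.range fun k => M' k)
      rw [← hU b]
      refine (Submodule.mem_span_range_iff_exists_fun ℤ).2 ⟨U b, ?_⟩
      funext n
      simp [Matrix.mul_apply]
    exact this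
  refine ⟨fun q hq => ⟨heq q hq.1, fun a => hq.2 (e a)⟩, Set.Subset.antisymm ?_ ?_⟩
  · rintro _ ⟨q, hq, rfl⟩
    rw [mem_splitClosure_relaxation hT] at hq ⊢
    refine ⟨heq q hq.1, ?_⟩
    rw [← hD']
    exact comp_mem_region he hq.2
  · intro q hq
    rw [mem_splitClosure_relaxation hT, ← hD'] at hq
    obtain ⟨x', hx', hxe⟩ := exists_comp_eq_of_mem_region hT he hw _ hq.2
    have hM' := (eq_graphMap_iff hT (q := graphMap T M' x')).1 rfl
    refine ⟨graphMap T M' x', (mem_splitClosure_relaxation hT ..).2 ⟨hM', hx'⟩, ?_⟩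
    refine Prod.ext hxe (funext fun b => ?_)
    have h := heq _ hM' b
    have h2 := hq.1 b
    rw [← hxe] at h2
    have hT' : (T : ℝ) ≠ 0 := by exact_mod_cast hT.ne'
    exact mul_left_cancel₀ hT' (h.symm.trans h2)

end BoxSplit

namespace PESPInstance

/-! ### Free augmentations -/

open scoped Classical in
theorem mem_cycleSpace_iff (I : PESPInstance.{u, v}) (γ : I.A → ℤ) :
    γ ∈ I.cycleSpace ↔ ∀ i : I.V,
      ∑ a, γ a * (if I.src a = i then 1 else 0) = ∑ a, γ a * (if I.tgt a = i then 1 else 0) := by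
  simp only [mul_ite, mul_one, mul_zero, ← Finset.sum_filter]
  rfl

theorem sum_extend_mul {A N : Type*} [Fintype A] [Fintype N] {e : A → N}
    (he : Function.Injective e) (γ : A → ℤ) (g : N → ℤ) :
    ∑ n, Function.extend e γ 0 n * g n = ∑ a, γ a * g (e a) := by
  refine (Fintype.sum_of_injective e he _ _ ?_ ?_).symm
  · intro n hn
    rw [Function.extend_apply' _ _ _ (by simpa using hn)]
    simp
  · intro a
    rw [he.extend_apply]

/-- What a free augmentation preserves: period and bounds of the old arcs, and the cycles supported
on the old arcs; every new arc is free. -/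
theorem IsFreeAugmentation.properties {I I' : PESPInstance.{u, v}} {e : I.A → I'.A}
    (h : IsFreeAugmentation I I' e) :
    Function.Injective e ∧ I'.T = I.T ∧ I'.lower ∘ e = I.lower ∧ I'.upper ∘ e = I.upper ∧
      (∀ a, a ∉ Set.range e → I'.upper a - I'.lower a = (I'.T : ℤ) - 1) ∧
      ∀ γ : I.A → ℤ, Function.extend e γ 0 ∈ I'.cycleSpace ↔ γ ∈ I.cycleSpace := by
  classical
  induction h with
  | refl =>
    refine ⟨Function.injective_id, rfl, rfl, rfl, fun a ha => (ha ⟨a, rfl⟩).elim, fun γ => ?_⟩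
    have : Function.extend id γ 0 = γ := funext fun a => Function.injective_id.extend_apply _ _ a
    rw [this]
  | @step I' I'' e e' _ hs ih =>
    obtain ⟨he, hT, hl, hu, hw, hc⟩ := ih
    obtain ⟨f, abar, hf, he', hr, -, hst, hT', hb, hfree⟩ := hs
    refine ⟨he'.comp he, hT'.trans hT, ?_, ?_, ?_, fun γ => ?_⟩
    · funext a
      rw [← hl]
      exact (hb (e a)).1
    · funext a
      rw [← hu]
      exact (hb (e a)).2.1
    · intro a ha
      by_cases hab : a = abar
      · rw [hab]
        exact hfree
      · obtain ⟨a', rfl⟩ := (hr a).2 hab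
        rw [(hb a').1, (hb a').2.1, hT']
        exact hw a' fun ⟨b, hb'⟩ => ha ⟨b, by rw [Function.comp_apply, hb']⟩
    · have hcomp : Function.extend (e' ∘ e) γ 0 =
          Function.extend e' (Function.extend e γ 0) 0 := by
        funext n
        by_cases hn : n ∈ Set.range e'
        · obtain ⟨a, rfl⟩ := hn
          rw [he'.extend_apply]
          by_cases ha : a ∈ Set.range e
          · obtain ⟨b, rfl⟩ := ha
            rw [he.extend_apply]
            exact (he'.comp he).extend_apply γ 0 b
          · rw [Function.extend_apply' γ _ a (by simpa using ha)]
            exact Function.extend_apply' _ _ _ fun ⟨b, hb'⟩ => ha ⟨b, he' hb'⟩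
        · rw [Function.extend_apply' (Function.extend e γ 0) _ n (by simpa using hn)]
          exact Function.extend_apply' _ _ _ fun ⟨b, hb'⟩ => hn ⟨e b, hb'⟩
      rw [hcomp, ← hc γ, mem_cycleSpace_iff, mem_cycleSpace_iff]
      simp only [sum_extend_mul he', (hst _).1, (hst _).2]
      constructor
      · intro h i
        simpa only [hf.eq_iff] using h (f i)
      · intro h i'
        by_cases hi : i' ∈ Set.range f
        · obtain ⟨i, rfl⟩ := hi
          simpa only [hf.eq_iff] using h i
        · have : ∀ i, f i ≠ i' := fun i hi' => hi ⟨i, hi'⟩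
          simp [this]

theorem fracPolytope_eq_relaxation (I : PESPInstance.{u, v}) {B : Type*} (Γ : Matrix B I.A ℤ) :
    I.fracPolytope Γ = BoxSplit.relaxation I.T I.lower I.upper Γ :=
  rfl

theorem existsUnique_transitionMatrix {I I' : PESPInstance.{u, v}} {e : I.A → I'.A}
    (h : IsFreeAugmentation I I' e) {B B' : Type*} [Fintype B'] {Γ : Matrix B I.A ℤ}
    {Γ' : Matrix B' I'.A ℤ} (hΓ : I.IsCycleMatrix Γ) (hΓ' : I'.IsCycleMatrix Γ') :
    ∃! U : Matrix B B' ℤ, IsTransitionMatrix e Γ Γ' U := by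
  have hrow : ∀ (U : Matrix B B' ℤ) b, (U * Γ') b = ∑ k, U b k • Γ' k := by
    intro U b
    funext n
    simp [Matrix.mul_apply]
  have hex : ∀ b, ∃ c : B' → ℤ, ∑ k, c k • Γ' k = Function.extend e (Γ b) 0 := by
    intro b
    have hmem := (h.properties.2.2.2.2.2 _).2 (hΓ.1 b).1
    rw [← hΓ'.2.2] at hmem
    exact (Submodule.mem_span_range_iff_exists_fun ℤ).1 hmem
  choose c hc using hex
  refine ⟨c, fun b => (hrow c b).trans (hc b), fun U hU => ?_⟩
  funext b k
  have hzero : ∑ k, (U b k - c b k) • Γ' k = 0 := by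
    simp only [sub_smul, Finset.sum_sub_distrib]
    rw [hc, ← hrow, hU b, sub_self]
  exact sub_eq_zero.1 (Fintype.linearIndependent_iff.1 hΓ'.2.1 _ hzero k)

theorem image_splitClosure_transitionProj {I I' : PESPInstance.{u, v}} {e : I.A → I'.A}
    (h : IsFreeAugmentation I I' e) {B B' : Type*} [Fintype B] [Fintype B'] {Γ : Matrix B I.A ℤ}
    {Γ' : Matrix B' I'.A ℤ} (hΓ : I.IsCycleMatrix Γ) (hΓ' : I'.IsCycleMatrix Γ')
    {U : Matrix B B' ℤ} (hU : IsTransitionMatrix e Γ Γ' U) :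
    Set.MapsTo (transitionProj e U) (I'.fracPolytope Γ') (I.fracPolytope Γ) ∧
      transitionProj e U '' splitClosure (I'.fracPolytope Γ') =
        splitClosure (I.fracPolytope Γ) := by
  obtain ⟨he, hT, hl, hu, hw, hc⟩ := h.properties
  rw [fracPolytope_eq_relaxation, fracPolytope_eq_relaxation, ← hl, ← hu, ← hT]
  refine BoxSplit.image_splitClosure_relaxation (by have := I'.two_le_T; omega) he hw hU ?_
  intro γ hγ
  rw [hΓ'.2.2] at hγ
  rw [hΓ.2.2]
  exact (hc γ).1 hγ

theorem image_splitClosure_coordProj {I I' : PESPInstance.{u, v}} {e : I.A → I'.A}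
    (h : IsFreeAugmentation I I' e) {B B' : Type*} [Fintype B] [Fintype B'] {Γ : Matrix B I.A ℤ}
    {Γ' : Matrix B' I'.A ℤ} (hΓ : I.IsCycleMatrix Γ) (hΓ' : I'.IsCycleMatrix Γ')
    {j : B → B'} (hj : ExtendsCycleMatrix e j Γ Γ') :
    Set.MapsTo (coordProj e j) (I'.fracPolytope Γ') (I.fracPolytope Γ) ∧
      coordProj e j '' splitClosure (I'.fracPolytope Γ') = splitClosure (I.fracPolytope Γ) := by
  classical
  -- The coordinate projection is the transition projection of the matrix that selects rows.
  let U : Matrix B B' ℤ := Matrix.of fun b k => if k = j b then 1 else 0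
  have hU : IsTransitionMatrix e Γ Γ' U := by
    intro b
    rw [← hj b]
    funext n
    simp [U, Matrix.mul_apply]
  have hproj : coordProj e j = transitionProj e U := by
    funext q
    refine Prod.ext rfl (funext fun b => ?_)
    simp [U, transitionProj, coordProj]
  rw [hproj]
  exact image_splitClosure_transitionProj h hΓ hΓ' hU

/-! ### The incidence-based formulation -/

open scoped Classical in
/-- The constraint matrix of the incidence-based formulation: the row of an arc `a` from `i` to `j`
encodes `x_a + π_i - π_j`. -/
noncomputable def incidenceMatrix (I : PESPInstance.{u, v}) : Matrix I.A (I.A ⊕ I.V) ℤ :=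
  fun a => Sum.elim (fun a' => if a = a' then 1 else 0)
    fun i => (if I.src a = i then 1 else 0) - if I.tgt a = i then 1 else 0

theorem incidencePolytope_eq_relaxation (I : PESPInstance.{u, v}) :
    I.incidencePolytope = BoxSplit.relaxation I.T (Sum.elim I.lower fun _ => 0)
      (Sum.elim I.upper fun _ => (I.T : ℤ) - 1) I.incidenceMatrix := by
  classical
  ext q
  simp only [incidencePolytope, BoxSplit.relaxation, Set.mem_ofPred_eq, Sum.forall, Sum.elim_inl,
    Sum.elim_inr, Int.cast_zero, Int.cast_sub, Int.cast_natCast, Int.cast_one]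
  refine and_congr_left fun _ => forall_congr' fun a => ?_
  have : ∑ n, (I.incidenceMatrix a n : ℝ) * q.1 n =
      q.1 (Sum.inl a) + (q.1 (Sum.inr (I.src a)) - q.1 (Sum.inr (I.tgt a))) := by
    simp [incidenceMatrix, sub_mul, Finset.sum_sub_distrib]
  rw [this]
  constructor <;> intro h <;> linarith

theorem image_splitClosure_incidenceProj (I : PESPInstance.{u, v}) {B : Type*} [Fintype B]
    {Γ : Matrix B I.A ℤ} (hΓ : I.IsCycleMatrix Γ) :
    Set.MapsTo (incidenceProj Γ) I.incidencePolytope (I.fracPolytope Γ) ∧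
      incidenceProj Γ '' splitClosure I.incidencePolytope = splitClosure (I.fracPolytope Γ) := by
  classical
  have hcomb : ∀ γ : I.A → ℤ, ∑ a, γ a • I.incidenceMatrix a = Sum.elim γ fun i =>
      ∑ a, γ a * (if I.src a = i then 1 else 0) - ∑ a, γ a * (if I.tgt a = i then 1 else 0) := by
    intro γ
    funext n
    rcases n with a | i
    · simp [incidenceMatrix, Finset.sum_apply]
    · simp [incidenceMatrix, Finset.sum_apply, mul_sub, Finset.sum_sub_distrib]
  have hext : ∀ γ : I.A → ℤ, Function.extend (Sum.inl : I.A → I.A ⊕ I.V) γ 0 =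
      Sum.elim γ fun _ => 0 := by
    intro γ
    funext n
    rcases n with a | i
    · exact Sum.inl_injective.extend_apply γ 0 a
    · rw [Function.extend_apply' _ _ _ (by simp)]
      rfl
  have hU : IsTransitionMatrix (Sum.inl : I.A → I.A ⊕ I.V) Γ I.incidenceMatrix Γ := by
    intro b
    have h1 : (Γ * I.incidenceMatrix) b = ∑ a, Γ b a • I.incidenceMatrix a := by
      funext n
      simp [Matrix.mul_apply]
    rw [h1, hcomb, hext]
    congr 1
    funext i
    exact sub_eq_zero.2 ((I.mem_cycleSpace_iff _).1 (hΓ.1 b).1 i)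
  rw [incidencePolytope_eq_relaxation, fracPolytope_eq_relaxation]
  refine BoxSplit.image_splitClosure_relaxation (l := Sum.elim I.lower fun _ => 0)
    (u := Sum.elim I.upper fun _ => (I.T : ℤ) - 1) (by have := I.two_le_T; omega)
    Sum.inl_injective ?_ hU ?_
  · rintro (a | i) hn
    · exact (hn ⟨a, rfl⟩).elim
    · simp
  · intro γ hγ
    obtain ⟨β, hβ⟩ := (Submodule.mem_span_range_iff_exists_fun ℤ).1 hγ
    rw [hcomb, hext] at hβ
    -- The arc coordinates of a combination of rows are its coefficients, the vertex coordinates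
    -- are the divergences.
    have hβγ : β = γ := funext fun a => congrFun hβ (Sum.inl a)
    rw [hΓ.2.2, mem_cycleSpace_iff, ← hβγ]
    exact fun i => sub_eq_zero.1 (congrFun hβ (Sum.inr i))

end PESPInstance

theorem mainTheorem2 :
    (∀ (I I' : PESPInstance.{u, v}) (e : I.A → I'.A),
      PESPInstance.IsFreeAugmentation I I' e →
      ∀ (B B' : Type w) [Fintype B] [Fintype B'] (Γ : Matrix B I.A ℤ) (Γ' : Matrix B' I'.A ℤ),
        I.IsCycleMatrix Γ → I'.IsCycleMatrix Γ' →
        (∀ j : B → B', ExtendsCycleMatrix e j Γ Γ' →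
          Set.MapsTo (coordProj e j) (I'.fracPolytope Γ') (I.fracPolytope Γ) ∧
          coordProj e j '' splitClosure (I'.fracPolytope Γ') =
            splitClosure (I.fracPolytope Γ)) ∧
        (∃! U : Matrix B B' ℤ, IsTransitionMatrix e Γ Γ' U) ∧
        (∀ U : Matrix B B' ℤ, IsTransitionMatrix e Γ Γ' U →
          Set.MapsTo (transitionProj e U) (I'.fracPolytope Γ') (I.fracPolytope Γ) ∧
          transitionProj e U '' splitClosure (I'.fracPolytope Γ') =
            splitClosure (I.fracPolytope Γ))) ∧
    (∀ (I : PESPInstance.{u, v}) (B : Type w) [Fintype B] (Γ : Matrix B I.A ℤ),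
      I.IsCycleMatrix Γ →
        Set.MapsTo (incidenceProj Γ) I.incidencePolytope (I.fracPolytope Γ) ∧
        incidenceProj Γ '' splitClosure I.incidencePolytope =
          splitClosure (I.fracPolytope Γ)) := by
  refine ⟨fun I I' e h B B' _ _ Γ Γ' hΓ hΓ' => ⟨fun j hj => ?_, ?_, fun U hU => ?_⟩,
    fun I B _ Γ hΓ => ?_⟩
  · exact PESPInstance.image_splitClosure_coordProj h hΓ hΓ' hj
  · exact PESPInstance.existsUnique_transitionMatrix h hΓ hΓ'
  · exact PESPInstance.image_splitClosure_transitionProj h hΓ hΓ' hU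
  · exact I.image_splitClosure_incidenceProj hΓ
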